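/- Let $n\ge 3$, let $\alpha$ be a primitive element of $\mathbb F_{2^n}$ (a generator of $\mathbb F_{2^n}^*$), and for $x\in\mathbb F_{2^n}^*$ let $M(x)$ be the $n\times n$ matrix over $\mathbb F_{2^n}$ with entries $$M(x)_{i,j}=\frac{1+x^{2^{i-1}+2^{j-1}}}{1+\alpha^{2^{i-1}+2^{j-1}}},\qquad 1\le i,j\le n.$$ Put $\Omega(M)=\{x\in\mathbb F_{2^n}^*\mid \det M(x)=0\}$. For a nonzero polynomial $u\in\mathbb F_2[z]$ write $\widetilde u(z)=z^{\deg u}u(z^{-1})$. Let $x\in\Omega(M)$, and let $$x=\alpha^{k_0}\,\frac{\widetilde u(\alpha)}{u(\alpha)}$$ be the canonical representation of $x$; that is, $k_0\in\mathbb Z$ and $u\in\mathbb F_2[z]$ satisfy this equation together with $\deg u<n$, $u(0)=1$, $\gcd(u,\widetilde u)=1$ and $|k_0|\le n-1-\deg u$. Then $$\operatorname{rank} M(x)=\deg u+|k_0|.$$ Moreover, let $\lambda\in\mathbb F_{2^n}^*$, let $s_j=\operatorname{Tr}_{\mathbb F_{2^n}/\mathbb F_2}(\lambda\alpha^j)$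 for $j\ge 0$ be the associated binary m-sequence, let $1\le t\le 2^n-1$, and let $G_t=(s_{i+j-2})_{1\le i\le n,\,1\le j\le t}\in\mathbb F_2^{n\times t}$. If $x=\alpha^t$, then also $$\operatorname{rank}(G_tG_t^{\top})=\deg u+|k_0|.$$ -/

import Mathlib

open Polynomial

namespace GramRank

noncomputable section

/-- The `n × n` matrix `M(x)` over `F`, with rows and columns indexed from `0`, whose `(i, j)` entry
is `(1 + x ^ (2 ^ i + 2 ^ j)) / (1 + α ^ (2 ^ i + 2 ^ j))`. -/
def M {F : Type*} [Field F] (n : ℕ) (α x : F) : Matrix (Fin n) (Fin n) F :=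
  Matrix.of fun i j =>
    (1 + x ^ (2 ^ (i : ℕ) + 2 ^ (j : ℕ))) / (1 + α ^ (2 ^ (i : ℕ) + 2 ^ (j : ℕ)))

/-- `Ω(M)`: the nonzero elements `x` of `F` for which `M(x)` is singular. -/
def Omega {F : Type*} [Field F] (n : ℕ) (α : F) : Set F :=
  {x | x ≠ 0 ∧ (M n α x).det = 0}

/-- The pair `(k, u)` is a canonical representation of `x`: the rational function
`z ^ k * ũ(z) / u(z)`, where `ũ = Polynomial.reverse u` is the reciprocal polynomial of `u`, takes
the value `x` at `α`, and `u` has degree less than `n`, constant term `1`, is coprime to `ũ`, and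
satisfies `|k| ≤ n - 1 - deg u`. -/
structure IsCanonicalRep {F : Type*} [Field F] [Algebra (ZMod 2) F] (n : ℕ) (α x : F)
    (k : ℤ) (u : (ZMod 2)[X]) : Prop where
  natDegree_lt : u.natDegree < n
  eval_zero : u.eval 0 = 1
  coprime : IsCoprime u u.reverse
  abs_le : |k| ≤ (n : ℤ) - 1 - (u.natDegree : ℤ)
  eq_eval : x = α ^ k * (aeval α u.reverse / aeval α u)

/-- The binary sequence `s t = Tr (lam * α ^ t)`, with the trace from `F` to the field with two
elements. It is an m-sequence when `α` is a primitive element and `lam ≠ 0`. -/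
def mSequence {F : Type*} [Field F] [Algebra (ZMod 2) F] (α lam : F) : ℕ → ZMod 2 :=
  fun t => Algebra.trace (ZMod 2) F (lam * α ^ t)

/-- The observability matrix `G_t` of a binary sequence `s`: the `n × t` matrix with `(i, j)` entry
`s (i + j)`, with rows and columns indexed from `0`. -/
def observabilityMatrix (n : ℕ) (s : ℕ → ZMod 2) (t : ℕ) : Matrix (Fin n) (Fin t) (ZMod 2) :=
  Matrix.of fun i j => s ((i : ℕ) + (j : ℕ))

end

end GramRank

/-!
Write `a i = α ^ 2 ^ i` for the conjugates of `α`, and let `R(z) = z ^ k * ũ(z) / u(z)`. Since `u`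
has coefficients in the field with two elements, `x = R(α)` gives `x ^ 2 ^ i = R(a i)`, and the
palindromic shape of `R` gives `R((a i)⁻¹) = R(a i)⁻¹`. Hence, up to an invertible diagonal factor
and the signs that disappear in characteristic two, `M(x)` is the Loewner matrix
`(R(a i) - R(b j)) / (a i - b j)` at the nodes `a i` and `b j = (a j)⁻¹` (`rank_M`).

The rank of a Loewner matrix of a rational function `P / Q` in lowest terms, with at least
`m = max (deg P) (deg Q)` nodes of each kind, is `m` (`rank_loewner`). After the columns are scaled
by the barycentric weights of the nodes `b`, a vector `r` is in the kernel exactly when the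
Lagrange interpolants `S` of `r` and `T` of `r * (P / Q)(b)` satisfy `P S = Q T` at every `a i`.
This equation also holds at every `b j`, so for degree reasons it is an identity of polynomials,
and coprimality forces `S = Q g`, `T = P g` with `deg g < n - m`. The kernel thus has dimension
`n - m`. Here `P` and `Q` are `z ^ k⁺ ũ(z)` and `z ^ k⁻ u(z)`, whose degrees have maximum
`deg u + |k| < n`.

For the Gram matrix, expanding the trace as the sum of the conjugates factors `G_t` over `F` as
`Vᵀ D W`, where `V` is the Vandermonde matrix of the `a i`, `D` is an invertible diagonal matrix
and `W l j = a l ^ j`. Summing geometric series gives `W Wᵀ = M(α ^ t)`, so `G_t G_tᵀ` is congruent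
to `M(α ^ t)` over `F` (`rank_gram`), and the rank does not depend on the field
(`rank_map_algebraMap`).
-/

namespace GramRank

open Matrix

/-! ### Rank under field extension -/

theorem rank_map_algebraMap {ι K L : Type*} [Fintype ι] [Field K] [Field L]
    [Algebra K L] (A : Matrix ι ι K) : (A.map (algebraMap K L)).rank = A.rank := by
  classical
  obtain ⟨T, T', D, h⟩ := Pivot.exists_list_transvec_mul_diagonal_mul_list_transvec A
  have hT : ∀ T : List (TransvectionStruct ι K),
      IsUnit (T.map TransvectionStruct.toMatrix).prod.det ∧
      IsUnit ((T.map TransvectionStruct.toMatrix).prod.map (algebraMap K L)).det := by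
    intro T
    have h1 := TransvectionStruct.det_toMatrix_prod T
    have h2 := RingHom.map_det (algebraMap K L) (T.map TransvectionStruct.toMatrix).prod
    rw [h1, map_one, RingHom.mapMatrix_apply] at h2
    exact ⟨h1 ▸ isUnit_one, h2 ▸ isUnit_one⟩
  rw [h, Matrix.map_mul, Matrix.map_mul, rank_mul_eq_left_of_isUnit_det _ _ (hT T').2,
    rank_mul_eq_left_of_isUnit_det _ _ (hT T').1, rank_mul_eq_right_of_isUnit_det _ _ (hT T).2,
    rank_mul_eq_right_of_isUnit_det _ _ (hT T).1, diagonal_map (map_zero _), rank_diagonal,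
    rank_diagonal]
  simp

/-! ### Loewner matrices -/

theorem exists_mul_eq_of_mul_eq_mul {K : Type*} [Field K] {P Q S T : K[X]} (hQ : Q ≠ 0)
    (h : IsCoprime P Q) (e : P * S = Q * T) : ∃ g, S = Q * g ∧ T = P * g := by
  obtain ⟨g, rfl⟩ : Q ∣ S := h.symm.dvd_of_dvd_mul_left ⟨T, e⟩
  exact ⟨g, rfl, mul_left_cancel₀ hQ (by rw [← e]; ring)⟩

/-- The Loewner matrix of a rational function `P / Q` in lowest terms, with at least as many row
nodes `a` and column nodes `b` as the degree `max (deg P) (deg Q)` of the function, has rank equal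
to that degree. -/
theorem rank_loewner {ι K : Type*} [Fintype ι] [Field K] {a b : ι → K}
    (ha : a.Injective) (hb : b.Injective) (hab : ∀ i j, a i ≠ b j) {P Q : K[X]}
    (hPQ : IsCoprime P Q) (hP : P.natDegree ≤ Fintype.card ι) (hQ : Q.natDegree ≤ Fintype.card ι)
    (hQa : ∀ i, Q.eval (a i) ≠ 0) (hQb : ∀ i, Q.eval (b i) ≠ 0) :
    (of fun i j => (P.eval (a i) / Q.eval (a i) - P.eval (b j) / Q.eval (b j)) / (a i - b j)).rank
      = max P.natDegree Q.natDegree := by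
  classical
  cases isEmpty_or_nonempty ι with
  | inl _ =>
    rw [Fintype.card_eq_zero] at hP hQ
    have := Matrix.rank_le_card_width (of fun i j => (P.eval (a i) / Q.eval (a i) -
      P.eval (b j) / Q.eval (b j)) / (a i - b j))
    simp only [Fintype.card_eq_zero] at this
    omega
  | inr hne =>
  obtain ⟨i₀⟩ := hne
  have hQ0 : Q ≠ 0 := fun h => hQa i₀ (by simp [h])
  set m := max P.natDegree Q.natDegree
  set w : ι → K := Lagrange.nodalWeight Finset.univ b with hw
  set A : Matrix ι ι K :=
    of fun i j => (P.eval (a i) / Q.eval (a i) - P.eval (b j) / Q.eval (b j)) / (a i - b j) with hA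
  have hb' : Set.InjOn b (Finset.univ : Finset ι) := hb.injOn
  have hw0 : ∀ i, w i ≠ 0 := fun i => Lagrange.nodalWeight_ne_zero hb' (Finset.mem_univ i)
  -- Scaling the columns by the barycentric weights turns `A` into an interpolation operator.
  have hdet : IsUnit (diagonal w).det := by
    rw [det_diagonal]; exact (Finset.prod_ne_zero_iff.2 fun i _ => hw0 i).isUnit
  rw [← rank_mul_eq_left_of_isUnit_det _ A hdet]
  let y : ι → K := fun j => P.eval (b j) / Q.eval (b j)
  have key : ∀ (r : ι → K) (i : ι),
      (Lagrange.nodal Finset.univ b).eval (a i) * ((A * diagonal w) *ᵥ r) i =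
      P.eval (a i) / Q.eval (a i) * (Lagrange.interpolate Finset.univ b r).eval (a i) -
        (Lagrange.interpolate Finset.univ b (y * r)).eval (a i) := by
    intro r i
    rw [Lagrange.eval_interpolate_not_at_node r fun j _ => hab i j,
      Lagrange.eval_interpolate_not_at_node (y * r) fun j _ => hab i j, mul_left_comm, ← mul_sub,
      Finset.mul_sum, ← Finset.sum_sub_distrib]
    congr 1
    refine Finset.sum_congr rfl fun j _ => ?_
    simp only [mul_diagonal, hA, of_apply, hw, Pi.mul_apply, y]
    ring
  have hmem : ∀ r : ι → K, (A * diagonal w) *ᵥ r = 0 ↔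
      ∀ i, P.eval (a i) / Q.eval (a i) * (Lagrange.interpolate Finset.univ b r).eval (a i) -
        (Lagrange.interpolate Finset.univ b (y * r)).eval (a i) = 0 := by
    intro r
    rw [funext_iff]
    refine forall_congr' fun i => ?_
    rw [← key r i]
    simp [Lagrange.eval_nodal_not_at_node fun j _ => hab i j]
  -- `Φ g` lists the values of `Q * g` at the nodes `b`; its range will be the kernel.
  let Φ : degreeLT K (Fintype.card ι - m) →ₗ[K] ι → K :=
    { toFun := fun g j => Q.eval (b j) * (g : K[X]).eval (b j)
      map_add' := fun g h => by ext; simp [mul_add]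
      map_smul' := fun c g => by ext; simp [mul_left_comm] }
  have hΦ : Function.Injective Φ := by
    rw [injective_iff_map_eq_zero]
    rintro ⟨g, hg⟩ h
    rw [mem_degreeLT] at hg
    ext1
    refine eq_zero_of_degree_lt_of_eval_index_eq_zero Finset.univ hb'
      (hg.trans_le (by rw [Finset.card_univ]; exact_mod_cast Nat.sub_le _ _)) fun j _ => ?_
    simpa [Φ, hQb j] using congrFun h j
  have hdeg : ∀ (R g : K[X]), R.natDegree ≤ m → g ∈ degreeLT K (Fintype.card ι - m) →
      (R * g).degree < (Finset.univ : Finset ι).card := by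
    intro R g hR hg
    by_cases h0 : R * g = 0
    · rw [h0, degree_zero]; exact WithBot.bot_lt_coe _
    have hg0 : g ≠ 0 := right_ne_zero_of_mul h0
    rw [mem_degreeLT, degree_eq_natDegree hg0, Nat.cast_lt] at hg
    rw [degree_eq_natDegree h0, Nat.cast_lt, natDegree_mul (left_ne_zero_of_mul h0) hg0,
      Finset.card_univ]
    omega
  have hker : LinearMap.ker (A * diagonal w).mulVecLin = LinearMap.range Φ := by
    ext r
    rw [LinearMap.mem_ker, mulVecLin_apply, hmem, LinearMap.mem_range]
    constructor
    · intro h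
      set S := Lagrange.interpolate Finset.univ b r with hS
      set T := Lagrange.interpolate Finset.univ b (y * r) with hT
      have hSd : S.degree < (Finset.univ : Finset ι).card := Lagrange.degree_interpolate_lt _ hb'
      have hTd : T.degree < (Finset.univ : Finset ι).card := Lagrange.degree_interpolate_lt _ hb'
      -- `P * S - Q * T` vanishes at all the `2n` nodes and has degree less than `2n`.
      have h0 : P * S - Q * T = 0 := by
        have hinj : Function.Injective (Sum.elim a b) :=
          ha.sumElim hb hab
        have hbd : ∀ R U : K[X], R.natDegree ≤ Fintype.card ι →
            U.degree < (Finset.univ : Finset ι).card →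
            (R * U).degree < (Finset.univ : Finset (ι ⊕ ι)).card := by
          intro R U hR hU
          by_cases h0 : R * U = 0
          · rw [h0, degree_zero]; exact WithBot.bot_lt_coe _
          have hU0 : U ≠ 0 := right_ne_zero_of_mul h0
          rw [degree_eq_natDegree hU0, Nat.cast_lt, Finset.card_univ] at hU
          rw [degree_eq_natDegree h0, Nat.cast_lt, natDegree_mul (left_ne_zero_of_mul h0) hU0,
            Finset.card_univ, Fintype.card_sum]
          omega
        refine eq_zero_of_degree_lt_of_eval_index_eq_zero Finset.univ (v := Sum.elim a b)
          hinj.injOn ((degree_sub_le _ _).trans_lt (max_lt (hbd _ _ hP hSd) (hbd _ _ hQ hTd))) ?_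
        rintro (i | j) -
        · have := h i
          have hq := hQa i
          rw [div_mul_eq_mul_div, sub_eq_zero, div_eq_iff hq] at this
          simp only [Sum.elim_inl, eval_sub, eval_mul, this]
          ring
        · have hq := hQb j
          simp only [Sum.elim_inr, eval_sub, eval_mul, hS, hT,
            Lagrange.eval_interpolate_at_node _ hb' (Finset.mem_univ j), Pi.mul_apply, y]
          field_simp
          ring
      obtain ⟨g, hSg, hTg⟩ := exists_mul_eq_of_mul_eq_mul hQ0 hPQ (sub_eq_zero.1 h0)
      have hg : g ∈ degreeLT K (Fintype.card ι - m) := by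
        rw [mem_degreeLT]
        by_cases hg0 : g = 0
        · rw [hg0, degree_zero]; exact WithBot.bot_lt_coe _
        rw [degree_eq_natDegree hg0, Nat.cast_lt]
        have h1 : Q.natDegree + g.natDegree < Fintype.card ι := by
          rwa [hSg, degree_eq_natDegree (mul_ne_zero hQ0 hg0), Nat.cast_lt, natDegree_mul hQ0 hg0,
            Finset.card_univ] at hSd
        have h2 : P.natDegree + g.natDegree < Fintype.card ι := by
          by_cases hP0 : P = 0
          · rw [hP0, natDegree_zero]; omega
          rwa [hTg, degree_eq_natDegree (mul_ne_zero hP0 hg0), Nat.cast_lt, natDegree_mul hP0 hg0,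
            Finset.card_univ] at hTd
        omega
      refine ⟨⟨g, hg⟩, ?_⟩
      ext j
      have := Lagrange.eval_interpolate_at_node r hb' (Finset.mem_univ j)
      rw [← hS, hSg, eval_mul] at this
      exact this
    · rintro ⟨⟨g, hg⟩, rfl⟩ i
      have hS : Q * g = Lagrange.interpolate Finset.univ b (Φ ⟨g, hg⟩) :=
        Lagrange.eq_interpolate_of_eval_eq _ hb' (hdeg _ _ (le_max_right _ _) hg)
          fun j _ => by simp [Φ]
      have hT : P * g = Lagrange.interpolate Finset.univ b (y * Φ ⟨g, hg⟩) :=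
        Lagrange.eq_interpolate_of_eval_eq _ hb' (hdeg _ _ (le_max_left _ _) hg)
          fun j _ => by
            have := hQb j
            simp only [eval_mul, Pi.mul_apply, y, Φ, LinearMap.coe_mk, AddHom.coe_mk]
            field_simp
      have := hQa i
      rw [← hS, ← hT, eval_mul, eval_mul]
      field_simp
      ring
  have h1 := (A * diagonal w).mulVecLin.finrank_range_add_finrank_ker
  rw [hker, LinearMap.finrank_range_of_inj hΦ, (degreeLTEquiv K _).finrank_eq,
    Module.finrank_fin_fun, Module.finrank_pi] at h1
  have : m ≤ Fintype.card ι := max_le hP hQ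
  rw [Matrix.rank]
  omega

/-! ### Conjugates of a primitive element -/

theorem conjugates_injective {F : Type*} [Field F] {n : ℕ} {α : F} (hn : 3 ≤ n)
    (hα : IsPrimitiveRoot α (2 ^ n - 1)) : Function.Injective fun i : Fin n => α ^ 2 ^ (i : ℕ) := by
  have hlt : ∀ i : Fin n, 2 ^ (i : ℕ) < 2 ^ n - 1 := by
    intro i
    obtain ⟨m, rfl⟩ : ∃ m, n = m + 1 := ⟨n - 1, by omega⟩
    have h1 : 2 ^ (i : ℕ) ≤ 2 ^ m := Nat.pow_le_pow_right two_pos (by omega)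
    have h2 : 2 ^ 2 ≤ 2 ^ m := Nat.pow_le_pow_right two_pos (by omega)
    rw [pow_succ]
    omega
  intro i j h
  exact Fin.ext (Nat.pow_right_injective le_rfl (hα.pow_inj (hlt i) (hlt j) h))

/-- The denominators in `M(x)` do not vanish: `2 ^ n - 1` does not divide `2 ^ i + 2 ^ j` when
`i, j < n` and `3 ≤ n`. -/
theorem conjugates_mul_ne_one {F : Type*} [Field F] {n : ℕ} {α : F} (hn : 3 ≤ n)
    (hα : IsPrimitiveRoot α (2 ^ n - 1)) (i j : Fin n) :
    α ^ 2 ^ (i : ℕ) * α ^ 2 ^ (j : ℕ) ≠ 1 := by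
  rw [← pow_add]
  intro h
  obtain ⟨m, rfl⟩ : ∃ m, n = m + 1 := ⟨n - 1, by omega⟩
  have hd := hα.dvd_of_pow_eq_one _ h
  obtain ⟨c, hc⟩ := hd
  -- The sum is at most `2 ^ n`, so the only possible positive multiple of `2 ^ n - 1` is itself.
  have h1 : 2 ^ (i : ℕ) ≤ 2 ^ m := Nat.pow_le_pow_right two_pos (by omega)
  have h2 : 2 ^ (j : ℕ) ≤ 2 ^ m := Nat.pow_le_pow_right two_pos (by omega)
  have h3 : 2 ^ 2 ≤ 2 ^ m := Nat.pow_le_pow_right two_pos (by omega)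
  have h4 : 0 < 2 ^ (i : ℕ) := by positivity
  have h5 : 0 < 2 ^ (j : ℕ) := by positivity
  rw [pow_succ] at hc
  have hc1 : c = 1 := by
    rcases Nat.lt_or_ge c 2 with h | h
    · interval_cases c
      · omega
      · rfl
    · have := Nat.mul_le_mul_left (2 ^ m * 2 - 1) h
      omega
  rw [hc1] at hc
  -- If both exponents were less than `m`, the sum would be at most `2 ^ m`; if both equal `m`, it
  -- would be `2 ^ (m + 1)`; otherwise it lies between `2 ^ m + 1` and `2 ^ m + 2 ^ (m - 1)`.
  obtain ⟨l, rfl⟩ : ∃ l, m = l + 1 := ⟨m - 1, by omega⟩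
  have hs : ∀ i : Fin (l + 1 + 1), 2 ^ (i : ℕ) = 2 ^ (l + 1) ∨ 2 ^ (i : ℕ) ≤ 2 ^ l := by
    intro i
    rcases Nat.lt_or_ge (i : ℕ) (l + 1) with h | h
    · exact Or.inr (Nat.pow_le_pow_right two_pos (by omega))
    · exact Or.inl (congrArg _ (by omega))
  have h6 : 2 ^ 1 ≤ 2 ^ l := Nat.pow_le_pow_right two_pos (by omega)
  have e : 2 ^ (l + 1) = 2 ^ l * 2 := pow_succ _ _
  rcases hs i with hi | hi <;> rcases hs j with hj | hj <;> omega

/-! ### Reciprocal polynomials -/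

theorem aeval_inv_reverse {K A : Type*} [CommSemiring K] [Field A] [Algebra K A] (p : K[X]) {y : A}
    (hy : y ≠ 0) : aeval y⁻¹ p.reverse = aeval y p / y ^ p.natDegree := by
  let _ := invertibleOfNonzero hy
  rw [eq_div_iff (pow_ne_zero _ hy), ← invOf_eq_inv]
  exact eval₂_reverse_mul_pow _ _ _

theorem isCoprime_X_pow_left {K : Type*} [Field K] {p : K[X]} (hp : p.eval 0 ≠ 0) (l : ℕ) :
    IsCoprime (X ^ l) p := by
  refine IsCoprime.pow_left ((irreducible_X.coprime_iff_not_dvd).2 ?_)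
  rwa [X_dvd_iff, coeff_zero_eq_eval_zero]

/-- The rational function `X ^ k * ũ / u` is in lowest terms when its negative or positive power of
`X` is put into the denominator or the numerator. -/
theorem isCoprime_num_den {K : Type*} [Field K] {u : K[X]} (h0 : u.eval 0 ≠ 0)
    (hc : IsCoprime u u.reverse) (k : ℤ) :
    IsCoprime (X ^ k.toNat * u.reverse) (X ^ (-k).toNat * u) := by
  have hu : u ≠ 0 := by rintro rfl; simp at h0
  have h1 : u.reverse.eval 0 ≠ 0 := by
    rwa [← coeff_zero_eq_eval_zero, coeff_zero_reverse, leadingCoeff_ne_zero]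
  refine IsCoprime.mul_left (IsCoprime.mul_right ?_ (isCoprime_X_pow_left h0 _))
    (IsCoprime.mul_right (isCoprime_X_pow_left h1 _).symm hc.symm)
  rcases le_total 0 k with h | h
  · rw [Int.toNat_of_nonpos (neg_nonpos.2 h), pow_zero]; exact isCoprime_one_right
  · rw [Int.toNat_of_nonpos h, pow_zero]; exact isCoprime_one_left

theorem natDegree_reverse_of_eval_zero_ne_zero {K : Type*} [Semiring K] {u : K[X]}
    (h0 : u.eval 0 ≠ 0) : u.reverse.natDegree = u.natDegree := by
  rw [reverse_natDegree, natTrailingDegree_eq_zero.2 (Or.inr (by rwa [coeff_zero_eq_eval_zero])),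
    Nat.sub_zero]

/-! ### The ranks of `M(x)` and of the Gram matrix -/

section Frobenius

variable {F : Type*} [Field F] [Algebra (ZMod 2) F] {n : ℕ} {α : F}

theorem aeval_pow_two_pow (p : (ZMod 2)[X]) (y : F) (i : ℕ) :
    aeval (y ^ 2 ^ i) p = aeval y p ^ 2 ^ i := by
  induction i with
  | zero => simp
  | succ i ih => rw [pow_succ, pow_mul, ← expand_aeval, ZMod.expand_card, map_pow, ih, ← pow_mul]

/-- A root `α` of `p` would make all `n` conjugates of `α` roots of `p`. -/
theorem aeval_ne_zero (hn : 3 ≤ n) (hα : IsPrimitiveRoot α (2 ^ n - 1)) {p : (ZMod 2)[X]}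
    (hp : p ≠ 0) (hd : p.natDegree < n) : aeval α p ≠ 0 := by
  intro h
  refine hp ((Polynomial.map_eq_zero (algebraMap (ZMod 2) F)).1 ?_)
  refine eq_zero_of_degree_lt_of_eval_index_eq_zero Finset.univ
    (conjugates_injective hn hα).injOn ?_ fun i _ => ?_
  · rw [degree_map, Finset.card_univ, Fintype.card_fin]
    exact degree_le_natDegree.trans_lt (by exact_mod_cast hd)
  · rw [eval_map_algebraMap, aeval_pow_two_pow, h, zero_pow (by positivity)]

/-- The matrix `M(x)` is the Loewner matrix of `z ^ k * ũ(z) / u(z)` at the conjugates of `α` and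
their inverses, up to an invertible diagonal factor. -/
theorem rank_M (hn : 3 ≤ n) (hα : IsPrimitiveRoot α (2 ^ n - 1)) {x : F} {k : ℤ} {u : (ZMod 2)[X]}
    (hrep : IsCanonicalRep n α x k u) : (M n α x).rank = u.natDegree + k.natAbs := by
  have hu0 : u.eval 0 ≠ 0 := by rw [hrep.eval_zero]; exact one_ne_zero
  have hu : u ≠ 0 := by rintro rfl; simp at hu0
  have hdeg := natDegree_reverse_of_eval_zero_ne_zero hu0
  have hα0 : α ≠ 0 := hα.ne_zero (by
    have : 2 ^ 3 ≤ 2 ^ n := Nat.pow_le_pow_right two_pos hn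
    omega)
  have huα : aeval α u ≠ 0 := aeval_ne_zero hn hα hu hrep.natDegree_lt
  have hrα : aeval α u.reverse ≠ 0 :=
    aeval_ne_zero hn hα (by rwa [Ne, reverse_eq_zero]) (hdeg ▸ hrep.natDegree_lt)
  have hx0 : x ≠ 0 := by
    rw [hrep.eq_eval]; exact mul_ne_zero (zpow_ne_zero _ hα0) (div_ne_zero hrα huα)
  have := charP_of_injective_algebraMap (algebraMap (ZMod 2) F).injective 2
  set a : Fin n → F := fun i => α ^ 2 ^ (i : ℕ) with ha
  have ha0 : ∀ i, a i ≠ 0 := fun i => pow_ne_zero _ hα0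
  have hainj : a.Injective := conjugates_injective hn hα
  have hab : ∀ i j, a i ≠ (a j)⁻¹ := fun i j h =>
    conjugates_mul_ne_one hn hα i j ((mul_eq_one_iff_eq_inv₀ (ha0 j)).2 h)
  have hua : ∀ i, aeval (a i) u ≠ 0 := fun i => by
    rw [ha, aeval_pow_two_pow]; exact pow_ne_zero _ huα
  have hra : ∀ i, aeval (a i) u.reverse ≠ 0 := fun i => by
    rw [ha, aeval_pow_two_pow]; exact pow_ne_zero _ hrα
  set f := algebraMap (ZMod 2) F
  set P : (ZMod 2)[X] := X ^ k.toNat * u.reverse with hP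
  set Q : (ZMod 2)[X] := X ^ (-k).toNat * u with hQ
  have hPQ : IsCoprime (P.map f) (Q.map f) :=
    (isCoprime_num_den hu0 hrep.coprime k).map (mapRingHom f)
  have hPd : (P.map f).natDegree = k.toNat + u.natDegree := by
    rw [natDegree_map, hP, natDegree_X_pow_mul _ (by rwa [Ne, reverse_eq_zero]), hdeg, add_comm]
  have hQd : (Q.map f).natDegree = (-k).toNat + u.natDegree := by
    rw [natDegree_map, hQ, natDegree_X_pow_mul _ hu, add_comm]
  have hkn := hrep.abs_le
  rw [Int.abs_eq_natAbs] at hkn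
  have hR : ∀ y : F, y ≠ 0 → (P.map f).eval y / (Q.map f).eval y =
      y ^ k * (aeval y u.reverse / aeval y u) := by
    intro y hy
    rw [eval_map_algebraMap, eval_map_algebraMap, hP, hQ, map_mul, map_mul, map_pow, map_pow,
      aeval_X, mul_div_mul_comm, ← zpow_natCast, ← zpow_natCast, ← zpow_sub₀ hy,
      Int.toNat_sub_toNat_neg]
  have hRa : ∀ i, (P.map f).eval (a i) / (Q.map f).eval (a i) = x ^ 2 ^ (i : ℕ) := by
    intro i
    have hz : a i ^ k = (α ^ k) ^ 2 ^ (i : ℕ) := by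
      change (α ^ 2 ^ (i : ℕ)) ^ k = _
      rw [← zpow_natCast, ← zpow_natCast, ← _root_.zpow_mul, ← _root_.zpow_mul, mul_comm]
    rw [hR _ (ha0 i), hz, ha, aeval_pow_two_pow, aeval_pow_two_pow, ← div_pow, hrep.eq_eval,
      mul_pow]
  have huinv : ∀ i, aeval (a i)⁻¹ u = aeval (a i) u.reverse / (a i) ^ u.natDegree := by
    intro i
    have := aeval_inv_reverse u (inv_ne_zero (ha0 i))
    rw [inv_inv, inv_pow, div_inv_eq_mul] at this
    rw [this, mul_div_cancel_right₀ _ (pow_ne_zero _ (ha0 i))]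
  -- The rational function `R = P / Q` satisfies `R (y⁻¹) = (R y)⁻¹`.
  have hRb : ∀ i, (P.map f).eval (a i)⁻¹ / (Q.map f).eval (a i)⁻¹ = (x ^ 2 ^ (i : ℕ))⁻¹ := by
    intro i
    rw [← hRa i, hR _ (ha0 i), hR _ (inv_ne_zero (ha0 i)), huinv, aeval_inv_reverse u (ha0 i),
      div_div_div_cancel_right₀ (pow_ne_zero _ (ha0 i)), mul_inv, inv_div, _root_.inv_zpow]
  have hQa : ∀ i, (Q.map f).eval (a i) ≠ 0 := by
    intro i
    rw [eval_map_algebraMap, hQ, map_mul, map_pow, aeval_X]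
    exact mul_ne_zero (pow_ne_zero _ (ha0 i)) (hua i)
  have hQb : ∀ i, (Q.map f).eval (a i)⁻¹ ≠ 0 := by
    intro i
    rw [eval_map_algebraMap, hQ, map_mul, map_pow, aeval_X, huinv]
    exact mul_ne_zero (pow_ne_zero _ (inv_ne_zero (ha0 i)))
      (div_ne_zero (hra i) (pow_ne_zero _ (ha0 i)))
  have hL := rank_loewner hainj (b := fun i => (a i)⁻¹) (fun i j h => hainj (inv_injective h))
    hab hPQ (by rw [Fintype.card_fin]; omega) (by rw [Fintype.card_fin]; omega) hQa hQb
  set L : Matrix (Fin n) (Fin n) F := of fun i j =>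
    ((P.map f).eval (a i) / (Q.map f).eval (a i) -
      (P.map f).eval (a j)⁻¹ / (Q.map f).eval (a j)⁻¹) / (a i - (a j)⁻¹) with hLdef
  have hM : M n α x = L * diagonal fun j : Fin n => x ^ 2 ^ (j : ℕ) / a j := by
    ext i j
    have h1 : 1 + a i * a j ≠ 0 := fun h =>
      conjugates_mul_ne_one hn hα i j (CharTwo.add_eq_zero.1 h).symm
    have h2 : x ^ 2 ^ (j : ℕ) ≠ 0 := pow_ne_zero _ hx0
    have h3 := ha0 j
    have h4 : a i - (a j)⁻¹ = (1 + a i * a j) / a j := by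
      rw [eq_div_iff h3, sub_mul, inv_mul_cancel₀ h3, CharTwo.sub_eq_add, add_comm]
    rw [mul_diagonal, hLdef, of_apply, hRa, hRb, h4]
    simp only [M, of_apply, pow_add]
    rw [CharTwo.sub_eq_add]
    change _ / (1 + a i * a j) = _
    field_simp
    ring
  have hdet : IsUnit (diagonal fun j : Fin n => x ^ 2 ^ (j : ℕ) / a j).det := by
    rw [det_diagonal]
    exact (Finset.prod_ne_zero_iff.2 fun i _ =>
      div_ne_zero (pow_ne_zero _ hx0) (ha0 i)).isUnit
  rw [hM, rank_mul_eq_left_of_isUnit_det _ _ hdet, hL, hPd, hQd]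
  omega

/-- The Gram matrix of the observability matrix becomes congruent to `M(α ^ t)` over `F`. -/
theorem rank_gram (hn : 3 ≤ n) (hF : Nat.card F = 2 ^ n) (hα : IsPrimitiveRoot α (2 ^ n - 1))
    {lam : F} (hlam : lam ≠ 0) (t : ℕ) :
    (observabilityMatrix n (mSequence α lam) t *
      (observabilityMatrix n (mSequence α lam) t)ᵀ).rank = (M n α (α ^ t)).rank := by
  have := charP_of_injective_algebraMap (algebraMap (ZMod 2) F).injective 2
  have hfin : Finite F := Nat.finite_of_card_ne_zero (by rw [hF]; positivity)
  have hrank : Module.finrank (ZMod 2) F = n := by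
    have h := Module.natCard_eq_pow_finrank (K := ZMod 2) (V := F)
    rw [hF, Nat.card_zmod] at h
    exact (Nat.pow_right_injective le_rfl h).symm
  set a : Fin n → F := fun i => α ^ 2 ^ (i : ℕ) with ha
  set D : Matrix (Fin n) (Fin n) F := diagonal fun l => lam ^ 2 ^ (l : ℕ) with hD
  set W : Matrix (Fin n) (Fin t) F := of fun l j => a l ^ (j : ℕ) with hW
  have hG : (observabilityMatrix n (mSequence α lam) t).map (algebraMap (ZMod 2) F) =
      (vandermonde a)ᵀ * D * W := by
    ext i j
    rw [map_apply, observabilityMatrix, of_apply, mSequence,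
      FiniteField.algebraMap_trace_eq_sum_pow, hrank, Nat.card_zmod, Finset.sum_range, Matrix.mul_apply]
    refine Finset.sum_congr rfl fun l _ => ?_
    rw [hD, mul_diagonal, transpose_apply, vandermonde_apply, hW, of_apply, ha]
    ring
  have hWW : W * Wᵀ = M n α (α ^ t) := by
    ext i j
    have h1 : a i * a j ≠ 1 := conjugates_mul_ne_one hn hα i j
    rw [Matrix.mul_apply]
    simp only [transpose_apply, hW, of_apply, ← mul_pow]
    rw [Fin.sum_univ_eq_sum_range (fun l => (a i * a j) ^ l), geom_sum_eq h1, M, of_apply,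
      pow_right_comm α t, pow_add α, CharTwo.sub_eq_add, CharTwo.sub_eq_add, add_comm 1, add_comm 1]
  have hV : IsUnit (vandermonde a).det :=
    (det_vandermonde_ne_zero_iff.2 (conjugates_injective hn hα)).isUnit
  have hDu : IsUnit D.det := by
    rw [hD, det_diagonal]
    exact (Finset.prod_ne_zero_iff.2 fun i _ => pow_ne_zero _ hlam).isUnit
  have hE : IsUnit ((vandermonde a)ᵀ * D).det := by
    rw [det_mul, det_transpose]; exact hV.mul hDu
  rw [← rank_map_algebraMap (L := F), Matrix.map_mul, transpose_map, hG, transpose_mul,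
    Matrix.mul_assoc, ← Matrix.mul_assoc W, hWW, rank_mul_eq_right_of_isUnit_det _ _ hE,
    rank_mul_eq_left_of_isUnit_det _ _ (by rwa [det_transpose])]

end Frobenius

end GramRank

theorem mainTheorem3 (n : ℕ) (hn : 3 ≤ n) {F : Type*} [Field F] [Algebra (ZMod 2) F]
    (hF : Nat.card F = 2 ^ n) (α : F) (hα : IsPrimitiveRoot α (2 ^ n - 1))
    (x : F) (hx : x ∈ GramRank.Omega n α) (k : ℤ) (u : Polynomial (ZMod 2))
    (hrep : GramRank.IsCanonicalRep n α x k u) :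
    (GramRank.M n α x).rank = u.natDegree + k.natAbs ∧
    ∀ lam : F, lam ≠ 0 → ∀ t : ℕ, 1 ≤ t → t ≤ 2 ^ n - 1 → x = α ^ t →
      (GramRank.observabilityMatrix n (GramRank.mSequence α lam) t *
        (GramRank.observabilityMatrix n (GramRank.mSequence α lam) t).transpose).rank =
          u.natDegree + k.natAbs := by
  refine ⟨GramRank.rank_M hn hα hrep, fun lam hlam t _ _ hxt => ?_⟩
  rw [GramRank.rank_gram hn hF hα hlam, ← hxt, GramRank.rank_M hn hα hrep]
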